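/- **Setting.** For each $n$ let $\mathcal L_n$ be a probability law of a triple $(\boldsymbol X,\boldsymbol Y,\boldsymbol Z)\in\mathbb R\times\mathbb R\times\mathbb R^{p_n}$, and let $(X,Y,Z)=\{(X_i,Y_i,Z_i)\}_{i=1}^n$ be i.i.d. from $\mathcal L_n$. Write $\mu_{n,y}(z)=\mathbb E_{\mathcal L_n}[\boldsymbol Y\mid \boldsymbol Z=z]$. Let $\widehat{\mathcal L}_n(\cdot\mid z)$ be a conditional law of the predictor given the covariates, learned (measurably) from $(X,Z)$, with conditional mean $\widehat\mu_{n,x}(z)$ and conditional variance $\mathrm{Var}_{\widehat{\mathcal L}_n}[X_i\mid Z_i]$ at $z=Z_i$, and let $\widehat\mu_{n,y}$ be a real-valued function learned (measurably) from $(Y,Z)$. Given the data $(X,Y,Z)$, let $\widetilde X=(\widetilde X_1,\dots,\widetilde X_n)$ have law $\prod_{i=1}^n\widehat{\mathcal L}_n(\cdot\mid Z_i)$. Define the resampled dCRT-hat statistic $$T_n(\widetilde X,X,Y,Z)=\frac1{\sqrt n}\sum_{i=1}^n(\widetilde X_i-\widehat\mu_{n,x}(Z_i))(Y_i-\widehat\mu_{n,y}(Z_i))$$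 and its conditional variance under the resampling law, $$\widehat S_n^2=\mathrm{Var}_{\widehat{\mathcal L}_n}[T_n(\widetilde X,X,Y,Z)\mid X,Y,Z]=\frac1n\sum_{i=1}^n\mathrm{Var}_{\widehat{\mathcal L}_n}[X_i\mid Z_i]\,(Y_i-\widehat\mu_{n,y}(Z_i))^2 .$$ **Theorem.** Suppose that * (NDG1) $\mathbb P_{\mathcal L_n}[\widehat S_n^2\ge\epsilon]\to1$ for some $\epsilon>0$; * (NDG2) for all $n$ and all $i\le n$, almost surely, each of $\mathrm{Var}_{\widehat{\mathcal L}_n}[X_i\mid Z_i]$, $(Y_i-\widehat\mu_{n,y}(Z_i))^2$ and $(Y_i-\mu_{n,y}(Z_i))^2$ is positive and finite; * (Lyap-1) for some $\delta>0$, $$\frac1{n^{1+\delta/2}}\sum_{i=1}^n|Y_i-\widehat\mu_{n,y}(Z_i)|^{2+\delta}\,\mathbb E_{\widehat{\mathcal L}_n}\!\left[|\widetilde X_i-\widehat\mu_{n,x}(Z_i)|^{2+\delta}\mid X,Z\right]\to0\quad\text{in probability.}$$ Then $\widehat S_n^{-1}T_n(\widetilde X,X,Y,Z)$ converges in distribution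 to $N(0,1)$ conditionally on $(X,Y,Z)$, that is, for every $t\in\mathbb R$, $$\mathbb P\!\left[\widehat S_n^{-1}T_n(\widetilde X,X,Y,Z)\le t\mid X,Y,Z\right]\to\Phi(t)\quad\text{in probability,}$$ where $\Phi$ is the standard normal distribution function. Consequently, for every $\alpha\in(0,1)$, the dCRT-hat critical value, i.e. the conditional quantile $$C_n(X,Y,Z)=\inf\left\{t:\mathbb P\!\left[\widehat S_n^{-1}T_n(\widetilde X,X,Y,Z)\le t\mid X,Y,Z\right]\ge1-\alpha\right\}$$ (computed with a regular conditional distribution given the data), converges in probability to $z_{1-\alpha}=\Phi^{-1}(1-\alpha)$. -/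

import Mathlib

open MeasureTheory ProbabilityTheory Filter Topology
open scoped ENNReal

noncomputable section

namespace DCRT

/-! ### Convergence notions, along a sequence of probability spaces -/

/-- `W n → c` in probability, where `W n` is defined on its own space `(Ω n, P n)`. -/
def TendstoInProb {Ω : ℕ → Type*} [∀ n, MeasurableSpace (Ω n)] {E : Type*} [EDist E]
    (P : ∀ n, Measure (Ω n)) (W : ∀ n, Ω n → E) (c : E) : Prop :=
  ∀ ε : ℝ≥0∞, 0 < ε → Tendsto (fun n => P n {ω | ε ≤ edist (W n ω) c}) atTop (𝓝 0)

/-- `W n` converges in distribution to the law `ν`, conditionally on the σ-algebras `F n`: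
`P[W n ≤ t | F n] → ν (-∞, t]` in probability at each continuity point `t` of the CDF of `ν`. -/
def CondTendstoInDistribution {Ω : ℕ → Type*} (F : ∀ n, MeasurableSpace (Ω n))
    [∀ n, MeasurableSpace (Ω n)] (P : ∀ n, Measure (Ω n)) (W : ∀ n, Ω n → ℝ)
    (ν : Measure ℝ) : Prop :=
  ∀ t : ℝ, ContinuousAt (cdf ν) t →
    TendstoInProb P (fun n => (P n)⟦{ω | W n ω ≤ t} | F n⟧) (cdf ν t)

/-- The `a`-quantile `inf {t | ν (-∞, t] ≥ a}` of a law on the real line. -/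
def quantile (a : ℝ) (ν : Measure ℝ) : ℝ :=
  sInf {t : ℝ | a ≤ ν.real (Set.Iic t)}

/-- The conditional `a`-quantile of `W` given the random element `D`, i.e. given `σ(D)`:
`inf {t | P[W ≤ t | D] ≥ a}`, with `P[W ≤ t | D]` read off the regular conditional
distribution of `W` given `D`. -/
def condQuantile {Ω β : Type*} [MeasurableSpace Ω] [MeasurableSpace β]
    (a : ℝ) (W : Ω → ℝ) (D : Ω → β) (P : Measure Ω) [IsFiniteMeasure P] (ω : Ω) : ℝ :=
  quantile a (condDistrib W D P (D ω))

/-! ### Data, learned laws and the test statistic -/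

/-- The covariate space. -/
abbrev Cov (p : ℕ) : Type := Fin p → ℝ

/-- A data set: `n` triples `(X i, Y i, Z i)`. -/
abbrev Sample (n p : ℕ) : Type := Fin n → ℝ × ℝ × Cov p

variable {n p : ℕ}

/-- The predictors of a data set. -/
def Sample.x (d : Sample n p) : Fin n → ℝ := fun i => (d i).1

/-- The responses of a data set. -/
def Sample.y (d : Sample n p) : Fin n → ℝ := fun i => (d i).2.1

/-- The covariates of a data set. -/
def Sample.z (d : Sample n p) : Fin n → Cov p := fun i => (d i).2.2

/-- A procedure that learns a conditional law of the predictor given the covariates from `(X, Z)`: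
the law at the covariate value `ζ`, learned from `(x, z)`, is the value at `((x, z), ζ)`. -/
abbrev LearnedLaw (n p : ℕ) : Type := Kernel (((Fin n → ℝ) × (Fin n → Cov p)) × Cov p) ℝ

/-- A procedure that learns the regression function of the response on the covariates from
`(Y, Z)`: the fitted value at `ζ`, learned from `(y, z)`, is the value at `((y, z), ζ)`. -/
abbrev LearnedMean (n p : ℕ) : Type := ((Fin n → ℝ) × (Fin n → Cov p)) × Cov p → ℝ

/-- The learned law of the `i`-th predictor given `Z i`. -/
def lawHat (κ : LearnedLaw n p) (d : Sample n p) (i : Fin n) : Measure ℝ :=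
  κ ((d.x, d.z), d.z i)

/-- `μ̂_{n,x}(Z i)`, the mean of the learned law at `Z i`. -/
def muHatX (κ : LearnedLaw n p) (d : Sample n p) (i : Fin n) : ℝ :=
  ∫ x, x ∂(lawHat κ d i)

/-- `μ̂_{n,y}(Z i)`. -/
def muHatY (m : LearnedMean n p) (d : Sample n p) (i : Fin n) : ℝ :=
  m ((d.y, d.z), d.z i)

/-- `μ_{n,y}(ζ) = E_L[Y | Z = ζ]` for the true law `L` of `(X, Y, Z)`. -/
def muY (L : Measure (ℝ × ℝ × Cov p)) [IsFiniteMeasure L] (ζ : Cov p) : ℝ :=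
  ∫ y, y ∂(condDistrib (fun w : ℝ × ℝ × Cov p => w.2.1) (fun w => w.2.2) L ζ)

/-- The resampling law given the data: the product of the learned laws at `Z 1, …, Z n`. -/
def resampleLaw (κ : LearnedLaw n p) (d : Sample n p) : Measure (Fin n → ℝ) :=
  Measure.pi (lawHat κ d)

/-- The resampled statistic
`T(x̃, X, Y, Z) = n^{-1/2} ∑ i, (x̃ i - μ̂_x(Z i)) (Y i - μ̂_y(Z i))`. -/
def stat (κ : LearnedLaw n p) (m : LearnedMean n p) (xt : Fin n → ℝ) (d : Sample n p) : ℝ :=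
  (1 / √(n : ℝ)) * ∑ i, (xt i - muHatX κ d i) * (d.y i - muHatY m d i)

/-- `Ŝ²`, the variance of the resampled statistic under the resampling law, the data being fixed. -/
def varHat (κ : LearnedLaw n p) (m : LearnedMean n p) (d : Sample n p) : ℝ :=
  Var[fun xt => stat κ m xt d; resampleLaw κ d]

/-- The normalized resampled statistic `Ŝ⁻¹ T(x̃, X, Y, Z)`. -/
def normStat (κ : LearnedLaw n p) (m : LearnedMean n p) (xt : Fin n → ℝ) (d : Sample n p) : ℝ :=
  (1 / √(varHat κ m d)) * stat κ m xt d

/-- The quantity in the conditional Lyapunov condition,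
`n^{-(1+δ/2)} ∑ i, |Y i - μ̂_y(Z i)|^{2+δ} E[|X̃ i - μ̂_x(Z i)|^{2+δ} | X, Z]`,
with values in `[0, ∞]`, as the moments of the learned law may be infinite. -/
def lyapunovSum (κ : LearnedLaw n p) (m : LearnedMean n p) (δ : ℝ) (d : Sample n p) : ℝ≥0∞ :=
  (∑ i, ENNReal.ofReal (|d.y i - muHatY m d i| ^ (2 + δ)) *
      ∫⁻ x, ENNReal.ofReal (|x - muHatX κ d i| ^ (2 + δ)) ∂(lawHat κ d i)) /
    ENNReal.ofReal ((n : ℝ) ^ (1 + δ / 2))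

end DCRT

end

/-! Freeze the data. Where Ŝ² ≥ ε and the learned variances are finite, the normalized statistic is,
under the resampling law, a sum of independent centred variables of total variance one. Its Lyapunov
ratio is at most ε^{-(1+δ/2)} times `lyapunovSum`.

A Lyapunov theorem uniform over finite families, `exists_forall_abs_map_sum_pi_Iic_sub_gaussian_lt`,
then gives a bound valid for each fixed data set
(`exists_forall_abs_map_normStat_Iic_sub_gaussian_lt`). By (NDG1) and (Lyap-1) the data sets it
misses have vanishing probability, so no subsequence argument is needed.
`condDistrib_comp_prodMk_ae_eq` identifies the frozen law with the conditional law. Quantiles follow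
because closeness of distribution functions at two points, one on each side of the Gaussian
quantile, already traps the quantile. -/

/-! ### Lyapunov's theorem by characteristic functions -/

theorem norm_prod_sub_prod_le_sum {ι : Type*} (s : Finset ι) (a b : ι → ℂ)
    (ha : ∀ i, ‖a i‖ ≤ 1) (hb : ∀ i, ‖b i‖ ≤ 1) :
    ‖∏ i ∈ s, a i - ∏ i ∈ s, b i‖ ≤ ∑ i ∈ s, ‖a i - b i‖ := by
  classical
  induction s using Finset.induction with
  | empty => simp
  | insert j s hj ih =>
    rw [Finset.prod_insert hj, Finset.prod_insert hj, Finset.sum_insert hj]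
    have hprod : ‖∏ i ∈ s, b i‖ ≤ 1 := by
      rw [norm_prod]
      exact Finset.prod_le_one (fun i _ => norm_nonneg _) (fun i _ => hb i)
    -- Exchange one factor at a time; all the other factors lie in the unit disc.
    calc ‖a j * ∏ i ∈ s, a i - b j * ∏ i ∈ s, b i‖
        = ‖a j * (∏ i ∈ s, a i - ∏ i ∈ s, b i) + (a j - b j) * ∏ i ∈ s, b i‖ := by
          congr 1; ring
      _ ≤ ‖a j‖ * ‖∏ i ∈ s, a i - ∏ i ∈ s, b i‖ + ‖a j - b j‖ * ‖∏ i ∈ s, b i‖ := by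
          refine (norm_add_le _ _).trans ?_
          rw [norm_mul, norm_mul]
      _ ≤ 1 * ‖∏ i ∈ s, a i - ∏ i ∈ s, b i‖ + ‖a j - b j‖ * 1 := by
          gcongr
          exact ha j
      _ ≤ ‖a j - b j‖ + ∑ i ∈ s, ‖a i - b i‖ := by linarith

/-- Used with v = s²V/2, to pass from the quadratic Taylor polynomial to the Gaussian factor. -/
theorem abs_exp_neg_sub_one_add_le {v : ℝ} (hv : 0 ≤ v) : |Real.exp (-v) - (1 - v)| ≤ v ^ 2 := by
  have h1 : 0 ≤ Real.exp (-v) - (1 - v) := by linarith [Real.add_one_le_exp (-v)]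
  rw [abs_of_nonneg h1]
  rcases le_total v 1 with h | h
  · have := Real.norm_exp_sub_one_sub_id_le (x := -v) (by simpa [abs_of_nonneg hv] using h)
    rw [Real.norm_eq_abs, Real.norm_eq_abs, sq_abs] at this
    nlinarith [le_abs_self (Real.exp (-v) - 1 - -v)]
  · have : Real.exp (-v) ≤ 1 := Real.exp_le_one_iff.2 (by linarith)
    nlinarith

/-- The second order Taylor remainder of `u ↦ exp (i u)`. -/
theorem norm_exp_mul_I_sub_taylor_le (u : ℝ) :
    ‖Complex.exp (u * Complex.I) - (1 + u * Complex.I - u ^ 2 / 2)‖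
      ≤ 4 * min (|u| ^ 3) (|u| ^ 2) := by
  rcases le_total |u| 1 with h | h
  -- The constant 4 bounds e here; in the other branch it comes from 2 + |u| + u²/2 ≤ 4u².
  · have h3 := Complex.norm_exp_sub_sum_le_norm_mul_exp (u * Complex.I) 3
    have hn : ‖(u : ℂ) * Complex.I‖ = |u| := by simp
    rw [hn] at h3
    have he : Real.exp |u| ≤ 4 :=
      (Real.exp_le_exp.2 h).trans (by linarith [Real.exp_one_lt_d9])
    have hs : ∑ m ∈ Finset.range 3, ((u : ℂ) * Complex.I) ^ m / (m.factorial : ℂ)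
        = 1 + u * Complex.I - u ^ 2 / 2 := by
      simp [Finset.sum_range_succ, mul_pow]
      ring
    rw [hs] at h3
    have hp : |u| ^ 3 ≤ |u| ^ 2 := pow_le_pow_of_le_one (abs_nonneg u) h (by norm_num)
    rw [min_eq_left hp]
    calc _ ≤ |u| ^ 3 * Real.exp |u| := h3
      _ ≤ |u| ^ 3 * 4 := by gcongr
      _ = _ := mul_comm _ _
  · have hp : |u| ^ 2 ≤ |u| ^ 3 := pow_le_pow_right₀ h (by norm_num)
    rw [min_eq_right hp]
    have h2 : ‖(1 : ℂ) + u * Complex.I - u ^ 2 / 2‖ ≤ 1 + |u| + |u| ^ 2 / 2 := by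
      refine (norm_sub_le _ _).trans ?_
      refine add_le_add ((norm_add_le _ _).trans ?_) ?_ <;> simp
    have h1 : ‖Complex.exp (u * Complex.I)‖ = 1 := Complex.norm_exp_ofReal_mul_I u
    refine (norm_sub_le _ _).trans ?_
    nlinarith

/-- Truncation at level r: below it one factor |x| of the cubic bound is at most r, above it the
quadratic bound is multiplied by (|x|/r)^δ ≥ 1. This covers every δ > 0. -/
theorem min_pow_le_truncated {δ r : ℝ} (hδ : 0 < δ) (hr : 0 < r) (s x : ℝ) :
    min (|s * x| ^ 3) (|s * x| ^ 2)
      ≤ |s| ^ 3 * r * x ^ 2 + s ^ 2 * r ^ (-δ) * |x| ^ (2 + δ) := by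
  have hx2 : |x| ^ 2 = x ^ 2 := sq_abs x
  have hs2 : |s| ^ 2 = s ^ 2 := sq_abs s
  have hA : 0 ≤ |s| ^ 3 * r * x ^ 2 := by positivity
  have hB : 0 ≤ s ^ 2 * r ^ (-δ) * |x| ^ (2 + δ) := by positivity
  rcases le_total |x| r with h | h
  · refine (min_le_left _ _).trans (le_trans ?_ (le_add_of_nonneg_right hB))
    rw [abs_mul, mul_pow, ← hx2]
    calc |s| ^ 3 * |x| ^ 3 = |s| ^ 3 * |x| * |x| ^ 2 := by ring
      _ ≤ _ := by gcongr
  · refine (min_le_right _ _).trans (le_trans ?_ (le_add_of_nonneg_left hA))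
    have hx : 0 < |x| := hr.trans_le h
    rw [abs_mul, mul_pow, hs2, Real.rpow_add hx, Real.rpow_neg hr.le]
    have : 1 ≤ (r ^ δ)⁻¹ * |x| ^ δ := by
      rw [inv_mul_eq_div, one_le_div (by positivity)]
      exact Real.rpow_le_rpow hr.le h hδ.le
    calc s ^ 2 * |x| ^ 2 = s ^ 2 * |x| ^ 2 * 1 := by ring
      _ ≤ s ^ 2 * |x| ^ 2 * ((r ^ δ)⁻¹ * |x| ^ δ) := by gcongr
      _ = _ := by
        rw [show |x| ^ (2 : ℝ) = |x| ^ 2 by exact_mod_cast Real.rpow_natCast |x| 2]; ring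

theorem sq_le_truncated {δ r : ℝ} (hδ : 0 < δ) (hr : 0 < r) (x : ℝ) :
    x ^ 2 ≤ r ^ 2 + r ^ (-δ) * |x| ^ (2 + δ) := by
  rcases le_total |x| r with h | h
  · have : x ^ 2 ≤ r ^ 2 := by rw [← sq_abs x]; gcongr
    have : 0 ≤ r ^ (-δ) * |x| ^ (2 + δ) := by positivity
    linarith
  · have hx : 0 < |x| := hr.trans_le h
    rw [Real.rpow_add hx, Real.rpow_neg hr.le]
    have : 1 ≤ (r ^ δ)⁻¹ * |x| ^ δ := by
      rw [inv_mul_eq_div, one_le_div (by positivity)]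
      exact Real.rpow_le_rpow hr.le h hδ.le
    have h2 : |x| ^ (2 : ℝ) = x ^ 2 := by
      rw [← sq_abs x]; exact_mod_cast Real.rpow_natCast |x| 2
    rw [h2]
    nlinarith [sq_nonneg x, sq_nonneg r]

/-- Comparison of the characteristic function of a centred law with the Gaussian one, in terms of
the second and the `(2 + δ)`-th moment. -/
theorem norm_charFun_sub_gaussian_le {μ : Measure ℝ} [IsProbabilityMeasure μ] {δ r : ℝ}
    (hδ : 0 < δ) (hr : 0 < r) (h2 : MemLp id 2 μ) (hmean : ∫ x, x ∂μ = 0)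
    (hint : Integrable (fun x => |x| ^ (2 + δ)) μ) (s : ℝ) :
    ‖charFun μ s - Complex.exp (((-(s ^ 2 * (∫ x, x ^ 2 ∂μ) / 2) : ℝ) : ℂ))‖
      ≤ (4 * |s| ^ 3 * r + s ^ 4 / 4 * (r ^ 2 + r ^ (-δ) * ∫ x, |x| ^ (2 + δ) ∂μ))
          * (∫ x, x ^ 2 ∂μ) + 4 * s ^ 2 * r ^ (-δ) * ∫ x, |x| ^ (2 + δ) ∂μ := by
  set V := ∫ x, x ^ 2 ∂μ with hV
  set M := ∫ x, |x| ^ (2 + δ) ∂μ with hM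
  have hsq : Integrable (fun x : ℝ => x ^ 2) μ := h2.integrable_sq
  have hid : Integrable (fun x : ℝ => x) μ := h2.integrable one_le_two
  have hV0 : 0 ≤ V := integral_nonneg fun x => sq_nonneg x
  have hVle : V ≤ r ^ 2 + r ^ (-δ) * M := by
    have : V ≤ ∫ x, (r ^ 2 + r ^ (-δ) * |x| ^ (2 + δ)) ∂μ :=
      integral_mono hsq ((integrable_const _).add (hint.const_mul _))
        fun x => sq_le_truncated hδ hr x
    rwa [integral_add (integrable_const _) (hint.const_mul _), integral_const_mul,
      integral_const, probReal_univ, one_smul] at this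
  -- Centring kills the linear term.
  have hT : ∫ x : ℝ, (1 + ((s * x : ℝ) : ℂ) * Complex.I - ((s * x : ℝ) : ℂ) ^ 2 / 2) ∂μ
      = ((1 - s ^ 2 * V / 2 : ℝ) : ℂ) := by
    have e1 : Integrable (fun x : ℝ => ((s * x : ℝ) : ℂ) * Complex.I) μ :=
      ((hid.const_mul s).ofReal).mul_const _
    have e2 : Integrable (fun x : ℝ => ((s * x : ℝ) : ℂ) ^ 2 / 2) μ := by
      have : Integrable (fun x : ℝ => (((s ^ 2 / 2) * x ^ 2 : ℝ) : ℂ)) μ :=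
        (hsq.const_mul _).ofReal
      refine this.congr (Eventually.of_forall fun x => ?_)
      push_cast; ring
    have e0 : Integrable (fun x : ℝ => 1 + ((s * x : ℝ) : ℂ) * Complex.I) μ :=
      (integrable_const _).add e1
    rw [integral_sub e0 e2, integral_add (integrable_const _) e1]
    have i1 : ∫ x : ℝ, ((s * x : ℝ) : ℂ) * Complex.I ∂μ = 0 := by
      rw [integral_mul_const, integral_complex_ofReal, integral_const_mul, hmean]; simp
    have i2 : ∫ x : ℝ, ((s * x : ℝ) : ℂ) ^ 2 / 2 ∂μ = ((s ^ 2 / 2 * V : ℝ) : ℂ) := by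
      rw [hV, ← integral_const_mul, ← integral_complex_ofReal]
      refine integral_congr_ae (Eventually.of_forall fun x => ?_)
      push_cast; ring
    rw [i1, i2, integral_const, probReal_univ]
    push_cast; simp; ring
  have hTint : Integrable
      (fun x : ℝ => 1 + ((s * x : ℝ) : ℂ) * Complex.I - ((s * x : ℝ) : ℂ) ^ 2 / 2) μ := by
    refine ((integrable_const _).add (((hid.const_mul s).ofReal).mul_const _)).sub ?_
    have : Integrable (fun x : ℝ => (((s ^ 2 / 2) * x ^ 2 : ℝ) : ℂ)) μ :=
      (hsq.const_mul _).ofReal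
    refine this.congr (Eventually.of_forall fun x => ?_)
    push_cast; ring
  have hEint : Integrable (fun x : ℝ => Complex.exp (((s * x : ℝ) : ℂ) * Complex.I)) μ := by
    refine Integrable.of_bound (C := 1) (by fun_prop) (Eventually.of_forall fun x => ?_)
    rw [Complex.norm_exp_ofReal_mul_I]
  have hA : ‖charFun μ s - ((1 - s ^ 2 * V / 2 : ℝ) : ℂ)‖
      ≤ 4 * |s| ^ 3 * r * V + 4 * s ^ 2 * r ^ (-δ) * M := by
    have hc : charFun μ s = ∫ x : ℝ, Complex.exp (((s * x : ℝ) : ℂ) * Complex.I) ∂μ := by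
      rw [charFun_apply_real]; push_cast; rfl
    rw [← hT, hc, ← integral_sub hEint hTint]
    refine (norm_integral_le_integral_norm _).trans ?_
    have hg : Integrable (fun x : ℝ => 4 * |s| ^ 3 * r * x ^ 2
        + 4 * s ^ 2 * r ^ (-δ) * |x| ^ (2 + δ)) μ := (hsq.const_mul _).add (hint.const_mul _)
    have := integral_mono (hEint.sub hTint).norm hg fun x => by
      have h := norm_exp_mul_I_sub_taylor_le (s * x)
      have h' := min_pow_le_truncated hδ hr s x
      simp only [Pi.sub_apply]
      linarith
    refine this.trans_eq ?_
    rw [integral_add (hsq.const_mul _) (hint.const_mul _), integral_const_mul, integral_const_mul]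
  -- Only one factor of V² is bounded by `hVle`; the other is kept, since the variances will be
  -- summed to one.
  have hB : ‖((1 - s ^ 2 * V / 2 : ℝ) : ℂ) - Complex.exp (((-(s ^ 2 * V / 2) : ℝ) : ℂ))‖
      ≤ s ^ 4 / 4 * (r ^ 2 + r ^ (-δ) * M) * V := by
    rw [← Complex.ofReal_exp, ← Complex.ofReal_sub, Complex.norm_real, Real.norm_eq_abs,
      abs_sub_comm]
    refine (abs_exp_neg_sub_one_add_le (by positivity)).trans ?_
    calc (s ^ 2 * V / 2) ^ 2 = s ^ 4 / 4 * V * V := by ring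
      _ ≤ _ := by gcongr
  calc _ ≤ _ := norm_sub_le_norm_sub_add_norm_sub _ ((1 - s ^ 2 * V / 2 : ℝ) : ℂ) _
    _ ≤ _ := add_le_add hA hB
    _ = _ := by ring

/-- Comparison of the characteristic function of a sum of independent centred variables of total
variance one with that of the standard Gaussian law. -/
theorem norm_charFun_map_sum_pi_sub_gaussian_le {ι : Type*} [Fintype ι] {μ : ι → Measure ℝ}
    [∀ i, IsProbabilityMeasure (μ i)] {δ r : ℝ} (hδ : 0 < δ) (hr : 0 < r)
    (h2 : ∀ i, MemLp id 2 (μ i)) (hmean : ∀ i, ∫ x, x ∂(μ i) = 0)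
    (hint : ∀ i, Integrable (fun x => |x| ^ (2 + δ)) (μ i))
    (hvar : ∑ i, ∫ x, x ^ 2 ∂(μ i) = 1) (s : ℝ) :
    ‖charFun ((Measure.pi μ).map (fun x => ∑ i, x i)) s - charFun (gaussianReal 0 1) s‖
      ≤ (4 * |s| ^ 3 * r + s ^ 4 / 4 * (r ^ 2 + r ^ (-δ) * ∑ i, ∫ x, |x| ^ (2 + δ) ∂(μ i)))
          + 4 * s ^ 2 * r ^ (-δ) * ∑ i, ∫ x, |x| ^ (2 + δ) ∂(μ i) := by
  set S := ∑ i, ∫ x, |x| ^ (2 + δ) ∂(μ i)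
  have hM0 : ∀ i, 0 ≤ ∫ x, |x| ^ (2 + δ) ∂(μ i) := fun i => integral_nonneg fun x => by positivity
  have hV0 : ∀ i, 0 ≤ ∫ x, x ^ 2 ∂(μ i) := fun i => integral_nonneg fun x => sq_nonneg x
  -- Total variance one splits the Gaussian factor into one factor per summand, with matching
  -- variances.
  have hg : charFun (gaussianReal 0 1) s
      = ∏ i, Complex.exp (((-(s ^ 2 * (∫ x, x ^ 2 ∂(μ i)) / 2) : ℝ) : ℂ)) := by
    rw [← Complex.exp_sum, charFun_gaussianReal, ← Complex.ofReal_sum, Finset.sum_neg_distrib,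
      ← Finset.sum_div, ← Finset.mul_sum, hvar]
    congr 1
    push_cast; simp
  rw [charFun_map_sum_pi_eq_prod, hg, Finset.prod_apply]
  refine (norm_prod_sub_prod_le_sum _ _ _ (fun i => norm_charFun_le_one _) fun i => ?_).trans ?_
  · rw [← Complex.ofReal_exp, Complex.norm_real, Real.norm_eq_abs, Real.abs_exp,
      Real.exp_le_one_iff]
    have := hV0 i
    have : 0 ≤ s ^ 2 * (∫ x, x ^ 2 ∂(μ i)) / 2 := by positivity
    linarith
  · calc _ ≤ ∑ i, ((4 * |s| ^ 3 * r + s ^ 4 / 4 * (r ^ 2 + r ^ (-δ) * S)) * (∫ x, x ^ 2 ∂(μ i))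
          + 4 * s ^ 2 * r ^ (-δ) * ∫ x, |x| ^ (2 + δ) ∂(μ i)) := by
          refine Finset.sum_le_sum fun i _ =>
            (norm_charFun_sub_gaussian_le hδ hr (h2 i) (hmean i) (hint i) s).trans ?_
          -- Makes the coefficient of the variance independent of `i`.
          have : ∫ x, |x| ^ (2 + δ) ∂(μ i) ≤ S :=
            Finset.single_le_sum (f := fun i => ∫ x, |x| ^ (2 + δ) ∂(μ i))
              (fun i _ => hM0 i) (Finset.mem_univ i)
          have := hV0 i
          gcongr
      _ = _ := by
          rw [Finset.sum_add_distrib, ← Finset.mul_sum, ← Finset.mul_sum, hvar, mul_one]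

/-- **Lyapunov's central limit theorem** for a triangular array of laws. -/
theorem tendsto_map_sum_pi_Iic_gaussian {ι : ℕ → Type*} [∀ k, Fintype (ι k)]
    {μ : ∀ k, ι k → Measure ℝ} [∀ k i, IsProbabilityMeasure (μ k i)] {δ : ℝ} (hδ : 0 < δ)
    (h2 : ∀ k i, MemLp id 2 (μ k i)) (hmean : ∀ k i, ∫ x, x ∂(μ k i) = 0)
    (hint : ∀ k i, Integrable (fun x => |x| ^ (2 + δ)) (μ k i))
    (hvar : ∀ k, ∑ i, ∫ x, x ^ 2 ∂(μ k i) = 1)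
    (hlim : Tendsto (fun k => ∑ i, ∫ x, |x| ^ (2 + δ) ∂(μ k i)) atTop (𝓝 0)) (t : ℝ) :
    Tendsto (fun k => ((Measure.pi (μ k)).map (fun x => ∑ i, x i)).real (Set.Iic t)) atTop
      (𝓝 (cdf (gaussianReal 0 1) t)) := by
  have hmeas : ∀ k, Measurable (fun x : ι k → ℝ => ∑ i, x i) := fun k => by fun_prop
  let ρ : ℕ → ProbabilityMeasure ℝ := fun k =>
    ⟨(Measure.pi (μ k)).map (fun x => ∑ i, x i),
      Measure.isProbabilityMeasure_map (hmeas k).aemeasurable⟩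
  let γ : ProbabilityMeasure ℝ := ⟨gaussianReal 0 1, inferInstance⟩
  have hchar : ∀ s : ℝ, Tendsto (fun k => charFun (ρ k) s) atTop (𝓝 (charFun γ s)) := by
    intro s
    rw [tendsto_iff_norm_sub_tendsto_zero, Metric.tendsto_nhds]
    intro ε hε
    have hcont : Tendsto (fun r : ℝ => 4 * |s| ^ 3 * r + s ^ 4 / 4 * r ^ 2) (𝓝[>] 0) (𝓝 0) := by
      have : Continuous (fun r : ℝ => 4 * |s| ^ 3 * r + s ^ 4 / 4 * r ^ 2) := by fun_prop
      have h := (this.tendsto 0).mono_left (nhdsWithin_le_nhds (s := Set.Ioi 0))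
      simpa using h
    -- The truncation level is fixed before `k` grows: it makes the terms free of the Lyapunov sum
    -- small, and the others vanish in the limit despite `r ^ (-δ)`.
    obtain ⟨r, hrε, hr⟩ := ((hcont.eventually_lt_const hε).and self_mem_nhdsWithin).exists
    have hr : 0 < r := hr
    have hb : Tendsto (fun k => (4 * |s| ^ 3 * r + s ^ 4 / 4 * (r ^ 2 + r ^ (-δ) *
        ∑ i, ∫ x, |x| ^ (2 + δ) ∂(μ k i))) + 4 * s ^ 2 * r ^ (-δ) *
        ∑ i, ∫ x, |x| ^ (2 + δ) ∂(μ k i)) atTop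
        (𝓝 ((4 * |s| ^ 3 * r + s ^ 4 / 4 * (r ^ 2 + r ^ (-δ) * 0)) + 4 * s ^ 2 * r ^ (-δ) * 0)) :=
      (tendsto_const_nhds.add ((tendsto_const_nhds.add (hlim.const_mul _)).const_mul _)).add
        (hlim.const_mul _)
    filter_upwards [hb.eventually_lt_const (by simpa using hrε)] with k hk
    rw [Real.dist_0_eq_abs, abs_of_nonneg (norm_nonneg _)]
    exact (norm_charFun_map_sum_pi_sub_gaussian_le hδ hr (h2 k) (hmean k) (hint k) (hvar k)
      s).trans_lt hk
  have hρ := ProbabilityMeasure.tendsto_of_tendsto_charFun hchar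
  have : NullSingletonClass (gaussianReal 0 1) := nullSingletonClass_gaussianReal one_ne_zero
  have h := ProbabilityMeasure.tendsto_measure_of_null_frontier_of_tendsto' hρ
    (E := Set.Iic t) (by
      rw [frontier_Iic]; exact measure_singleton (μ := gaussianReal 0 1) t)
  rw [cdf_eq_real]
  exact (ENNReal.tendsto_toReal (measure_ne_top _ _)).comp h

/-- Lyapunov's central limit theorem, in a form that is uniform over all finite families of laws. -/
theorem exists_forall_abs_map_sum_pi_Iic_sub_gaussian_lt {δ η : ℝ} (hδ : 0 < δ) (hη : 0 < η)
    (t : ℝ) : ∃ γ : ℝ, 0 < γ ∧ ∀ (n : ℕ) (μ : Fin n → Measure ℝ),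
      (∀ i, IsProbabilityMeasure (μ i)) → (∀ i, MemLp id 2 (μ i)) → (∀ i, ∫ x, x ∂(μ i) = 0) →
      (∀ i, Integrable (fun x => |x| ^ (2 + δ)) (μ i)) → ∑ i, ∫ x, x ^ 2 ∂(μ i) = 1 →
      ∑ i, ∫ x, |x| ^ (2 + δ) ∂(μ i) < γ →
      |((Measure.pi μ).map (fun x => ∑ i, x i)).real (Set.Iic t) - cdf (gaussianReal 0 1) t|
        < η := by
  -- Counterexamples for γ = 1/(k+1) would form a triangular array violating the limit theorem.
  by_contra! hcon
  have hpos : ∀ k : ℕ, (0 : ℝ) < 1 / ((k : ℝ) + 1) := fun k => by positivity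
  choose N μ hprob h2 hmean hint hvar hsmall hbig using fun k : ℕ => hcon _ (hpos k)
  have hlim : Tendsto (fun k => ∑ i, ∫ x, |x| ^ (2 + δ) ∂(μ k i)) atTop (𝓝 0) :=
    squeeze_zero (fun k => Finset.sum_nonneg fun i _ => integral_nonneg fun x => by positivity)
      (fun k => (hsmall k).le) tendsto_one_div_add_atTop_nhds_zero_nat
  have := tendsto_map_sum_pi_Iic_gaussian hδ h2 hmean hint hvar hlim t
  obtain ⟨k, hk⟩ := ((Metric.tendsto_nhds.1 this) η hη).exists
  exact (hbig k).not_gt hk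

/-! ### Measurability of the resampling law and of the statistic -/

namespace DCRT

theorem measurable_sample_x {n p : ℕ} : Measurable (Sample.x : Sample n p → _) := by
  unfold Sample.x; fun_prop

theorem measurable_sample_y {n p : ℕ} : Measurable (Sample.y : Sample n p → _) := by
  unfold Sample.y; fun_prop

theorem measurable_sample_z {n p : ℕ} : Measurable (Sample.z : Sample n p → _) := by
  unfold Sample.z; fun_prop

theorem measurable_sample_xz {n p : ℕ} (i : Fin n) :
    Measurable (fun d : Sample n p => ((d.x, d.z), d.z i)) :=
  (measurable_sample_x.prodMk measurable_sample_z).prodMk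
    ((measurable_pi_apply i).comp measurable_sample_z)

theorem measurable_sample_yz {n p : ℕ} (i : Fin n) :
    Measurable (fun d : Sample n p => ((d.y, d.z), d.z i)) :=
  (measurable_sample_y.prodMk measurable_sample_z).prodMk
    ((measurable_pi_apply i).comp measurable_sample_z)

instance isProbabilityMeasure_lawHat {n p : ℕ} (κ : LearnedLaw n p) [IsMarkovKernel κ]
    (d : Sample n p) (i : Fin n) : IsProbabilityMeasure (lawHat κ d i) := by
  unfold lawHat; infer_instance

instance isProbabilityMeasure_resampleLaw {n p : ℕ} (κ : LearnedLaw n p) [IsMarkovKernel κ]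
    (d : Sample n p) : IsProbabilityMeasure (resampleLaw κ d) := by
  unfold resampleLaw; infer_instance

theorem measurable_lawHat {n p : ℕ} (κ : LearnedLaw n p) (i : Fin n) :
    Measurable (fun d : Sample n p => lawHat κ d i) :=
  κ.measurable.comp (measurable_sample_xz i)

/-- Boxes form a generating π-system, and the mass of a box is a finite product of measurable
functions. -/
theorem measurable_resampleLaw {n p : ℕ} (κ : LearnedLaw n p) [IsMarkovKernel κ] :
    Measurable (fun d : Sample n p => resampleLaw κ d) := by
  refine Measurable.measure_of_isPiSystem_of_isProbabilityMeasure generateFrom_pi.symm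
    isPiSystem_pi ?_
  rintro _ ⟨s, hs, rfl⟩
  simp only [resampleLaw, Measure.pi_pi]
  exact Finset.measurable_prod _ fun i _ =>
    (Measure.measurable_coe (s := s i) (hs i (Set.mem_univ i))).comp (measurable_lawHat κ i)

/-- The resampling law as a kernel from data sets to vectors of predictors. -/
noncomputable def resampleKernel {n p : ℕ} (κ : LearnedLaw n p) [IsMarkovKernel κ] :
    Kernel (Sample n p) (Fin n → ℝ) where
  toFun := resampleLaw κ
  measurable' := measurable_resampleLaw κ

instance isMarkovKernel_resampleKernel {n p : ℕ} (κ : LearnedLaw n p) [IsMarkovKernel κ] :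
    IsMarkovKernel (resampleKernel κ) :=
  ⟨fun d => isProbabilityMeasure_resampleLaw κ d⟩

theorem measurable_muHatX {n p : ℕ} (κ : LearnedLaw n p) [IsMarkovKernel κ] (i : Fin n) :
    Measurable (fun d : Sample n p => muHatX κ d i) := by
  have h : StronglyMeasurable (fun a => ∫ x, x ∂(κ a)) :=
    StronglyMeasurable.integral_kernel (κ := κ) stronglyMeasurable_id
  exact h.measurable.comp (measurable_sample_xz i)

theorem measurable_muHatY {n p : ℕ} {m : LearnedMean n p} (hm : Measurable m) (i : Fin n) :
    Measurable (fun d : Sample n p => muHatY m d i) :=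
  hm.comp (measurable_sample_yz i)

theorem measurable_stat {n p : ℕ} (κ : LearnedLaw n p) [IsMarkovKernel κ] {m : LearnedMean n p}
    (hm : Measurable m) :
    Measurable (fun a : Sample n p × (Fin n → ℝ) => stat κ m a.2 a.1) := by
  unfold stat
  refine measurable_const.mul (Finset.measurable_sum _ fun i _ => ?_)
  refine Measurable.mul (Measurable.sub (by fun_prop) ((measurable_muHatX κ i).comp measurable_fst))
    (Measurable.sub ?_ ((measurable_muHatY hm i).comp measurable_fst))
  exact (measurable_pi_apply i).comp (measurable_sample_y.comp measurable_fst)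

theorem measurable_varHat {n p : ℕ} (κ : LearnedLaw n p) [IsMarkovKernel κ] {m : LearnedMean n p}
    (hm : Measurable m) : Measurable (fun d : Sample n p => varHat κ m d) := by
  have hs := measurable_stat κ hm
  have hmean : Measurable (fun d : Sample n p => ∫ xt, stat κ m xt d ∂(resampleKernel κ d)) :=
    (StronglyMeasurable.integral_kernel_prod_right' hs.stronglyMeasurable).measurable
  have hf : Measurable (fun a : Sample n p × (Fin n → ℝ) =>
      ‖stat κ m a.2 a.1 - ∫ xt, stat κ m xt a.1 ∂(resampleKernel κ a.1)‖ₑ ^ 2) :=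
    ((hs.sub (hmean.comp measurable_fst)).enorm).pow_const 2
  exact (hf.lintegral_kernel_prod_right' (κ := resampleKernel κ)).ennreal_toReal

theorem measurable_normStat {n p : ℕ} (κ : LearnedLaw n p) [IsMarkovKernel κ]
    {m : LearnedMean n p} (hm : Measurable m) :
    Measurable (fun a : Sample n p × (Fin n → ℝ) => normStat κ m a.2 a.1) := by
  unfold normStat
  exact (measurable_const.div ((measurable_varHat κ hm).comp measurable_fst).sqrt).mul
    (measurable_stat κ hm)

end DCRT

/-! ### Conditional laws given the data -/

/-- The conditional law of a function of `D` and `X` given `D` is obtained by freezing `D`. -/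
theorem condDistrib_comp_prodMk_ae_eq {Ω β γ δ : Type*} [MeasurableSpace Ω] [MeasurableSpace β]
    [MeasurableSpace γ] [StandardBorelSpace γ] [Nonempty γ]
    [MeasurableSpace δ] [StandardBorelSpace δ] [Nonempty δ]
    {P : Measure Ω} [IsFiniteMeasure P] {D : Ω → β} {X : Ω → γ} (hD : Measurable D)
    (hX : Measurable X) {f : β × γ → δ} (hf : Measurable f) :
    ∀ᵐ ω ∂P, condDistrib (fun ω => f (D ω, X ω)) D P (D ω)
      = (condDistrib X D P (D ω)).map (fun x => f (D ω, x)) := by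
  let η : Kernel β δ := (Kernel.id ×ₖ condDistrib X D P).map f
  have hη : ∀ b, η b = (condDistrib X D P b).map (fun x => f (b, x)) := fun b => by
    rw [Kernel.map_apply _ hf, Kernel.prod_apply, Kernel.id_apply, Measure.dirac_prod,
      Measure.map_map hf (by fun_prop)]
    rfl
  -- By uniqueness of conditional distributions, it is enough to match the joint law of `D` and f(D,
  -- X).
  have key : condDistrib (fun ω => f (D ω, X ω)) D P =ᵐ[P.map D] η := by
    refine condDistrib_ae_eq_of_measure_eq_compProd D
      (hf.comp (hD.prodMk hX)).aemeasurable ?_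
    have hg : Measurable (fun a : β × γ => (a.1, f a)) := measurable_fst.prodMk hf
    have h1 : P.map (fun ω => (D ω, f (D ω, X ω)))
        = (P.map D ⊗ₘ condDistrib X D P).map (fun a => (a.1, f a)) := by
      rw [compProd_map_condDistrib hX.aemeasurable, Measure.map_map hg (hD.prodMk hX)]
      rfl
    refine h1.trans ?_
    ext s hs
    rw [Measure.map_apply hg hs, Measure.compProd_apply (hg hs), Measure.compProd_apply hs]
    refine lintegral_congr fun b => ?_
    rw [hη b, Measure.map_apply (show Measurable fun x => f (b, x) from
      hf.comp measurable_prodMk_left) (measurable_prodMk_left hs)]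
    rfl
  filter_upwards [ae_of_ae_map hD.aemeasurable key] with ω hω
  rw [hω, hη]

/-! ### Stability of Gaussian quantiles -/

theorem strictMono_cdf_gaussianReal : StrictMono (cdf (gaussianReal 0 1)) := by
  intro a b hab
  rw [cdf_eq_real, cdf_eq_real]
  have hpos : 0 < (gaussianReal 0 1) (Set.Ioc a b) := by
    refine pos_iff_ne_zero.2 fun h => ?_
    -- Lebesgue measure is absolutely continuous with respect to the Gaussian law, so a
    -- nondegenerate interval cannot be null.
    have := gaussianReal_absolutelyContinuous' 0 one_ne_zero h
    simp at this
    linarith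
  have hdisj : Disjoint (Set.Iic a) (Set.Ioc a b) :=
    Set.disjoint_left.2 fun x hx hx' => (not_lt.2 hx) hx'.1
  rw [← Set.Iic_union_Ioc_eq_Iic hab.le, measureReal_union hdisj measurableSet_Ioc]
  have : 0 < (gaussianReal 0 1).real (Set.Ioc a b) :=
    ENNReal.toReal_pos hpos.ne' (measure_ne_top _ _)
  linarith

namespace DCRT

theorem quantile_set_subset {ν : Measure ℝ} [IsProbabilityMeasure ν] {a b : ℝ}
    (h : ν.real (Set.Iic b) < a) : ∀ t ∈ {t : ℝ | a ≤ ν.real (Set.Iic t)}, b < t := by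
  intro t ht
  by_contra! hle
  exact absurd (measureReal_mono (μ := ν) (Set.Iic_subset_Iic.2 hle)) (by
    have : a ≤ ν.real (Set.Iic t) := ht
    linarith)

/-- A real `sInf` is meaningful only for a nonempty set bounded below: `c` gives nonemptiness and
`b` the lower bound, hence both hypotheses here and in `quantile_le`. -/
theorem le_quantile {ν : Measure ℝ} [IsProbabilityMeasure ν] {a b c : ℝ}
    (hb : ν.real (Set.Iic b) < a) (hc : a ≤ ν.real (Set.Iic c)) : b ≤ quantile a ν :=
  le_csInf ⟨c, hc⟩ fun t ht => (quantile_set_subset hb t ht).le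

theorem quantile_le {ν : Measure ℝ} [IsProbabilityMeasure ν] {a b c : ℝ}
    (hb : ν.real (Set.Iic b) < a) (hc : a ≤ ν.real (Set.Iic c)) : quantile a ν ≤ c :=
  csInf_le ⟨b, fun t ht => (quantile_set_subset hb t ht).le⟩ hc

theorem cdf_lt_of_lt_quantile_gaussian {a b : ℝ} (ha : 0 < a)
    (h : b < quantile a (gaussianReal 0 1)) : cdf (gaussianReal 0 1) b < a := by
  by_contra! hle
  obtain ⟨c, hc⟩ := ((tendsto_cdf_atBot (gaussianReal 0 1)).eventually_lt_const ha).exists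
  rw [cdf_eq_real] at hle hc
  exact (quantile_le hc hle).not_gt h

theorem lt_cdf_of_quantile_gaussian_lt {a b : ℝ} (ha : a < 1)
    (h : quantile a (gaussianReal 0 1) < b) : a < cdf (gaussianReal 0 1) b := by
  obtain ⟨c, hc⟩ := ((tendsto_cdf_atTop (gaussianReal 0 1)).eventually_const_lt ha).exists
  rw [cdf_eq_real] at hc
  obtain ⟨t, ht, htb⟩ := exists_lt_of_csInf_lt (s := {t : ℝ | a ≤ (gaussianReal 0 1).real (Set.Iic t)})
    ⟨c, hc.le⟩ h
  have ht' : a ≤ cdf (gaussianReal 0 1) t := by rw [cdf_eq_real]; exact ht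
  exact ht'.trans_lt (strictMono_cdf_gaussianReal htb)

/-- If the distribution function of `ν` is close to the Gaussian one at two points, then its
quantile is close to the Gaussian one. -/
theorem exists_forall_abs_quantile_sub_gaussian_le {a ε : ℝ} (ha0 : 0 < a) (ha1 : a < 1)
    (hε : 0 < ε) : ∃ η : ℝ, 0 < η ∧ ∃ b c : ℝ, ∀ ν : Measure ℝ, IsProbabilityMeasure ν →
      |ν.real (Set.Iic b) - cdf (gaussianReal 0 1) b| < η →
      |ν.real (Set.Iic c) - cdf (gaussianReal 0 1) c| < η →
      |quantile a ν - quantile a (gaussianReal 0 1)| ≤ ε := by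
  set q := quantile a (gaussianReal 0 1) with hq
  have hlo := cdf_lt_of_lt_quantile_gaussian (b := q - ε) ha0 (by rw [← hq]; linarith)
  have hhi := lt_cdf_of_quantile_gaussian_lt (b := q + ε) ha1 (by rw [← hq]; linarith)
  -- The two test points are q ± ε, and η is the smaller gap between `a` and the Gaussian
  -- distribution function there.
  refine ⟨min (a - cdf (gaussianReal 0 1) (q - ε)) (cdf (gaussianReal 0 1) (q + ε) - a),
    lt_min (by linarith) (by linarith), q - ε, q + ε, fun ν hν h1 h2 => ?_⟩
  have h1' := (abs_lt.1 (h1.trans_le (min_le_left _ _))).2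
  have h2' := (abs_lt.1 (h2.trans_le (min_le_right _ _))).1
  have hb : ν.real (Set.Iic (q - ε)) < a := by linarith
  have hc : a ≤ ν.real (Set.Iic (q + ε)) := by linarith
  rw [abs_le]
  constructor
  · linarith [le_quantile hb hc]
  · linarith [quantile_le hb hc]

/-! ### The normalized statistic as a sum of independent variables -/

theorem memLp_two_summand {n p : ℕ} {κ : LearnedLaw n p} [IsMarkovKernel κ] {d : Sample n p}
    {i : Fin n} (h : eVar[id; lawHat κ d i] < ∞) (c : ℝ) :
    MemLp (fun x => c * (x - muHatX κ d i)) 2 (lawHat κ d i) := by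
  have hid := (evariance_lt_top_iff_memLp (X := id) (μ := lawHat κ d i) (by fun_prop)).1 h
  exact (hid.sub (memLp_const _)).const_mul c

theorem integral_summand {n p : ℕ} {κ : LearnedLaw n p} [IsMarkovKernel κ] {d : Sample n p}
    {i : Fin n} (h : eVar[id; lawHat κ d i] < ∞) (c : ℝ) :
    ∫ x, c * (x - muHatX κ d i) ∂(lawHat κ d i) = 0 := by
  have hid := (evariance_lt_top_iff_memLp (X := id) (μ := lawHat κ d i) (by fun_prop)).1 h
  have : Integrable (fun x : ℝ => x) (lawHat κ d i) := hid.integrable one_le_two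
  rw [integral_const_mul, integral_sub this (integrable_const _), integral_const, probReal_univ]
  simp [muHatX]

/-- Variances add under a product measure, and centring turns each variance into a second moment. -/
theorem varHat_eq_sum {n p : ℕ} {κ : LearnedLaw n p} [IsMarkovKernel κ] (m : LearnedMean n p)
    {d : Sample n p} (h : ∀ i, eVar[id; lawHat κ d i] < ∞) :
    varHat κ m d = ∑ i, ∫ x, (1 / √(n : ℝ) * (d.y i - muHatY m d i) * (x - muHatX κ d i)) ^ 2
      ∂(lawHat κ d i) := by
  have hs : (fun xt => stat κ m xt d) = ∑ i, fun xt : Fin n → ℝ =>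
      (fun x => 1 / √(n : ℝ) * (d.y i - muHatY m d i) * (x - muHatX κ d i)) (xt i) := by
    ext xt
    simp only [stat, Finset.sum_apply, Finset.mul_sum]
    exact Finset.sum_congr rfl fun i _ => by ring
  unfold varHat resampleLaw
  rw [hs]
  refine (variance_sum_pi (X := fun i x =>
    1 / √(n : ℝ) * (d.y i - muHatY m d i) * (x - muHatX κ d i))
    fun i => memLp_two_summand (h i) _).trans (Finset.sum_congr rfl fun i _ => ?_)
  exact variance_of_integral_eq_zero (by fun_prop) (integral_summand (h i) _)

/-- The law of the normalized statistic under the resampling law is that of a sum of independent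
variables. -/
theorem map_normStat_eq_map_sum_pi {n p : ℕ} (κ : LearnedLaw n p) [IsMarkovKernel κ]
    (m : LearnedMean n p) (d : Sample n p) :
    (resampleLaw κ d).map (fun xt => normStat κ m xt d)
      = (Measure.pi fun i => (lawHat κ d i).map fun x => 1 / √(varHat κ m d) *
          (1 / √(n : ℝ) * (d.y i - muHatY m d i)) * (x - muHatX κ d i)).map
          (fun x => ∑ i, x i) := by
  have hpi := Measure.pi_map_pi (μ := fun i => lawHat κ d i) (f := fun i x => 1 / √(varHat κ m d) *
          (1 / √(n : ℝ) * (d.y i - muHatY m d i)) * (x - muHatX κ d i))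
          (fun i => by fun_prop)
  rw [← hpi, Measure.map_map (by fun_prop) (by fun_prop)]
  unfold resampleLaw
  congr 1
  ext xt
  simp only [normStat, stat, Function.comp, Finset.mul_sum]
  exact Finset.sum_congr rfl fun i _ => by ring

/-- Homogeneity of degree 2 + δ: the factor n^{-1/2} yields exactly the normalization n^{-(1+δ/2)}.
-/
theorem sum_lintegral_rpow_summand {n p : ℕ} (κ : LearnedLaw n p) (m : LearnedMean n p)
    (d : Sample n p) {δ v : ℝ} (hn : 0 < n) (hv : 0 < v) :
    ∑ i, ∫⁻ x, ENNReal.ofReal (|1 / √v * (1 / √(n : ℝ) * (d.y i - muHatY m d i)) *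
        (x - muHatX κ d i)| ^ (2 + δ)) ∂(lawHat κ d i)
      = ENNReal.ofReal ((1 / √v) ^ (2 + δ)) * lyapunovSum κ m δ d := by
  have hn' : (0 : ℝ) < n := by exact_mod_cast hn
  have hpow : (1 / √(n : ℝ)) ^ (2 + δ) = ((n : ℝ) ^ (1 + δ / 2))⁻¹ := by
    rw [one_div, Real.inv_rpow (Real.sqrt_nonneg _), Real.sqrt_eq_rpow, ← Real.rpow_mul hn'.le]
    congr 2; ring
  unfold lyapunovSum
  rw [ENNReal.div_eq_inv_mul, ← ENNReal.ofReal_inv_of_pos (by positivity), ← hpow,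
    Finset.mul_sum, Finset.mul_sum]
  refine Finset.sum_congr rfl fun i _ => ?_
  rw [← lintegral_const_mul _ (by fun_prop), ← lintegral_const_mul _ (by fun_prop),
    ← lintegral_const_mul _ (by fun_prop)]
  refine lintegral_congr fun x => ?_
  rw [← ENNReal.ofReal_mul (by positivity), ← ENNReal.ofReal_mul (by positivity),
    ← ENNReal.ofReal_mul (by positivity)]
  congr 1
  rw [abs_mul, abs_mul, abs_mul, abs_of_nonneg (show 0 ≤ 1 / √v by positivity),
    abs_of_nonneg (show 0 ≤ 1 / √(n : ℝ) by positivity), Real.mul_rpow (by positivity)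
    (by positivity), Real.mul_rpow (by positivity) (by positivity), Real.mul_rpow (by positivity)
    (by positivity)]
  ring

/-- For data with non-degenerate resampling variance and small Lyapunov sum, the normalized
statistic is approximately standard Gaussian under the resampling law. -/
theorem exists_forall_abs_map_normStat_Iic_sub_gaussian_lt {δ η ε : ℝ} (hδ : 0 < δ) (hη : 0 < η)
    (hε : 0 < ε) (t : ℝ) : ∃ γ : ℝ≥0∞, 0 < γ ∧ ∀ (n p : ℕ) (κ : LearnedLaw n p),
      IsMarkovKernel κ → ∀ (m : LearnedMean n p) (d : Sample n p),
      (∀ i, eVar[id; lawHat κ d i] < ∞) → ε ≤ varHat κ m d → lyapunovSum κ m δ d < γ →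
      |((resampleLaw κ d).map (fun xt => normStat κ m xt d)).real (Set.Iic t)
        - cdf (gaussianReal 0 1) t| < η := by
  obtain ⟨γ, hγ, H⟩ := exists_forall_abs_map_sum_pi_Iic_sub_gaussian_lt hδ hη t
  have hK : 0 < (1 / √ε) ^ (2 + δ) := by positivity
  -- Dividing by Ŝ ≥ √ε inflates the Lyapunov sum by at most (1/√ε)^{2+δ}.
  refine ⟨ENNReal.ofReal (γ / (1 / √ε) ^ (2 + δ)), ENNReal.ofReal_pos.2 (by positivity),
    fun n p κ _ m d hvar hV hL => ?_⟩
  set v := varHat κ m d with hv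
  have hv0 : 0 < v := hε.trans_le hV
  -- An empty sample has variance zero, contradicting ε ≤ Ŝ².
  have hn : 0 < n := by
    rcases Nat.eq_zero_or_pos n with rfl | h
    · rw [hv, varHat_eq_sum m hvar] at hv0
      simp at hv0
    · exact h
  set c : Fin n → ℝ := fun i => 1 / √v * (1 / √(n : ℝ) * (d.y i - muHatY m d i)) with hc
  have hmeas : ∀ i, Measurable fun x => c i * (x - muHatX κ d i) := fun i => by fun_prop
  have hsum : ∑ i, ∫⁻ x, ENNReal.ofReal (|c i * (x - muHatX κ d i)| ^ (2 + δ)) ∂(lawHat κ d i)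
      < ENNReal.ofReal γ := by
    rw [hc, sum_lintegral_rpow_summand κ m d hn hv0]
    have hle : ENNReal.ofReal ((1 / √v) ^ (2 + δ)) ≤ ENNReal.ofReal ((1 / √ε) ^ (2 + δ)) := by
      apply ENNReal.ofReal_le_ofReal
      gcongr
    refine (mul_le_mul_left hle _).trans_lt ?_
    have : ENNReal.ofReal γ = ENNReal.ofReal ((1 / √ε) ^ (2 + δ))
        * ENNReal.ofReal (γ / (1 / √ε) ^ (2 + δ)) := by
      rw [← ENNReal.ofReal_mul hK.le, mul_div_cancel₀ _ hK.ne']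
    rw [this]
    exact ENNReal.mul_lt_mul_right (ENNReal.ofReal_pos.2 hK).ne' ENNReal.ofReal_ne_top hL
  -- Finiteness of the (2+δ)-th moments comes from the bound on their sum in [0, ∞].
  have hfin : ∀ i, ∫⁻ x, ENNReal.ofReal (|c i * (x - muHatX κ d i)| ^ (2 + δ)) ∂(lawHat κ d i)
      ≠ ∞ := fun i => ((Finset.single_le_sum (f := fun i => ∫⁻ x, ENNReal.ofReal
        (|c i * (x - muHatX κ d i)| ^ (2 + δ)) ∂(lawHat κ d i)) (fun _ _ => zero_le)
        (Finset.mem_univ i)).trans_lt (hsum.trans ENNReal.ofReal_lt_top)).ne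
  have hpowmeas : Measurable fun x : ℝ => |x| ^ (2 + δ) := by fun_prop
  rw [map_normStat_eq_map_sum_pi]
  refine H n _ (fun i => Measure.isProbabilityMeasure_map (hmeas i).aemeasurable)
    (fun i => ?_) (fun i => ?_) (fun i => ?_) ?_ ?_
  · rw [memLp_map_measure_iff (by fun_prop) (hmeas i).aemeasurable]
    exact memLp_two_summand (hvar i) _
  · rw [integral_map (hmeas i).aemeasurable (by fun_prop)]
    exact integral_summand (hvar i) _
  · rw [integrable_map_measure hpowmeas.aestronglyMeasurable (hmeas i).aemeasurable]
    refine (lintegral_ofReal_ne_top_iff_integrable ?_ ?_).1 (hfin i)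
    · exact (hpowmeas.comp (hmeas i)).aestronglyMeasurable
    · exact Eventually.of_forall fun x => by simp only [Function.comp, Pi.zero_apply]; positivity
  · have : ∀ i, ∫ x, x ^ 2 ∂((lawHat κ d i).map fun x => c i * (x - muHatX κ d i))
        = v⁻¹ * ∫ x, (1 / √(n : ℝ) * (d.y i - muHatY m d i) * (x - muHatX κ d i)) ^ 2
          ∂(lawHat κ d i) := fun i => by
      rw [integral_map (hmeas i).aemeasurable (by fun_prop), ← integral_const_mul]
      refine integral_congr_ae (Eventually.of_forall fun x => ?_)
      simp only [hc, mul_pow, div_pow, Real.sq_sqrt hv0.le]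
      ring
    rw [Finset.sum_congr rfl fun i _ => this i, ← Finset.mul_sum, ← varHat_eq_sum m hvar]
    exact inv_mul_cancel₀ hv0.ne'
  · have : ∀ i, ∫ x, |x| ^ (2 + δ) ∂((lawHat κ d i).map fun x => c i * (x - muHatX κ d i))
        = (∫⁻ x, ENNReal.ofReal (|c i * (x - muHatX κ d i)| ^ (2 + δ)) ∂(lawHat κ d i)).toReal :=
      fun i => by
        rw [integral_map (hmeas i).aemeasurable hpowmeas.aestronglyMeasurable]
        exact integral_eq_lintegral_of_nonneg_ae (Eventually.of_forall fun x => by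
          simp only [Pi.zero_apply]; positivity) (hpowmeas.comp (hmeas i)).aestronglyMeasurable
    rw [Finset.sum_congr rfl fun i _ => this i, ← ENNReal.toReal_sum fun i _ => hfin i]
    exact (ENNReal.lt_ofReal_iff_toReal_lt (hsum.trans ENNReal.ofReal_lt_top).ne).1 hsum

end DCRT

/-! ### Convergence in probability through exceptional events -/

theorem ENNReal.edist_zero_eq_self (x : ℝ≥0∞) : edist x 0 = x := by
  induction x with
  | top => rfl
  | coe x =>
    refine (show edist (x : ℝ≥0∞) 0 = edist x 0 from rfl).trans ?_
    rw [edist_nndist, NNReal.nndist_zero_eq_val']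

namespace DCRT

/-- Convergence in probability from deterministic bounds on events of probability tending to one. -/
theorem tendstoInProb_real_of_forall_ae {Ω : ℕ → Type*} [∀ n, MeasurableSpace (Ω n)]
    {P : ∀ n, Measure (Ω n)} {W : ∀ n, Ω n → ℝ} {c : ℝ}
    (h : ∀ ε : ℝ, 0 < ε → ∃ B : ∀ n, Set (Ω n), Tendsto (fun n => P n (B n)) atTop (𝓝 0) ∧
      ∀ n, ∀ᵐ ω ∂(P n), ω ∉ B n → |W n ω - c| < ε) : TendstoInProb P W c := by
  intro ε hε
  -- The threshold may be ∞, so it is replaced by a smaller positive real one.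
  obtain ⟨ε', hε'0, hε'⟩ : ∃ ε' : ℝ, 0 < ε' ∧ ENNReal.ofReal ε' ≤ ε := by
    obtain ⟨r, hr0, hr⟩ := ENNReal.lt_iff_exists_nnreal_btwn.1 hε
    exact ⟨r, by exact_mod_cast hr0, by rw [ENNReal.ofReal_coe_nnreal]; exact hr.le⟩
  obtain ⟨B, hB, hW⟩ := h ε' hε'0
  refine tendsto_of_tendsto_of_tendsto_of_le_of_le tendsto_const_nhds hB (fun _ => zero_le)
    fun n => measure_mono_ae ?_
  filter_upwards [hW n] with ω hω hle
  by_contra hnot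
  have h1 : edist (W n ω) c < ENNReal.ofReal ε' := by
    rw [edist_dist, Real.dist_eq]
    exact (ENNReal.ofReal_lt_ofReal_iff hε'0).2 (hω hnot)
  have h2 : ε ≤ edist (W n ω) c := hle
  exact absurd (h1.trans_le hε') h2.not_gt

theorem tendsto_measure_lt_of_tendsto_measureReal_le {Ω : ℕ → Type*}
    [∀ n, MeasurableSpace (Ω n)] {P : ∀ n, Measure (Ω n)} [∀ n, IsProbabilityMeasure (P n)]
    {V : ∀ n, Ω n → ℝ} (hV : ∀ n, Measurable (V n)) {ε : ℝ}
    (h : Tendsto (fun n => (P n).real {ω | ε ≤ V n ω}) atTop (𝓝 1)) :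
    Tendsto (fun n => P n {ω | V n ω < ε}) atTop (𝓝 0) := by
  have h1 : ∀ n, P n {ω | V n ω < ε} = ENNReal.ofReal (1 - (P n).real {ω | ε ≤ V n ω}) := by
    intro n
    have hset : {ω | V n ω < ε} = {ω | ε ≤ V n ω}ᶜ := by ext; simp
    rw [hset, ← probReal_compl_eq_one_sub (measurableSet_le measurable_const (hV n)),
      ofReal_measureReal]
  simp_rw [h1]
  have := ENNReal.tendsto_ofReal (h.const_sub 1)
  simpa using this

theorem tendsto_measure_union_zero {Ω : ℕ → Type*} [∀ n, MeasurableSpace (Ω n)]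
    {P : ∀ n, Measure (Ω n)} {A B : ∀ n, Set (Ω n)}
    (hA : Tendsto (fun n => P n (A n)) atTop (𝓝 0))
    (hB : Tendsto (fun n => P n (B n)) atTop (𝓝 0)) :
    Tendsto (fun n => P n (A n ∪ B n)) atTop (𝓝 0) :=
  tendsto_of_tendsto_of_tendsto_of_le_of_le tendsto_const_nhds (by simpa using hA.add hB)
    (fun _ => zero_le) fun _ => measure_union_le _ _

end DCRT

/-! ### The limit theorem -/

theorem theorem1
    -- the covariate dimensions and the true laws of the triples (X, Y, Z)
    (p : ℕ → ℕ) (L : ∀ n, Measure (ℝ × ℝ × DCRT.Cov (p n))) [∀ n, IsProbabilityMeasure (L n)]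
    -- the learned conditional laws of X given Z, and the learned conditional means of Y given Z
    (κ : ∀ n, DCRT.LearnedLaw n (p n)) [∀ n, IsMarkovKernel (κ n)]
    (m : ∀ n, DCRT.LearnedMean n (p n)) (hm : ∀ n, Measurable (m n))
    -- the data and the resampled predictors, on arbitrary probability spaces
    {Ω : ℕ → Type*} [∀ n, MeasurableSpace (Ω n)]
    (P : ∀ n, Measure (Ω n)) [∀ n, IsProbabilityMeasure (P n)]
    (D : ∀ n, Ω n → DCRT.Sample n (p n)) (hD : ∀ n, Measurable (D n))
    (Xt : ∀ n, Ω n → Fin n → ℝ) (hXt : ∀ n, Measurable (Xt n))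
    -- the triples are i.i.d. with law `L n`
    (hindep : ∀ n, iIndepFun (fun i ω => D n ω i) (P n))
    (hlaw : ∀ n i, (P n).map (fun ω => D n ω i) = L n)
    -- given the data, the resampled predictors are drawn from the product of the learned laws
    (hresample : ∀ n, ∀ᵐ ω ∂(P n),
      condDistrib (Xt n) (D n) (P n) (D n ω) = DCRT.resampleLaw (κ n) (D n ω))
    -- (NDG1)
    (hNDG1 : ∃ ε : ℝ, 0 < ε ∧
      Tendsto (fun n => (P n).real {ω | ε ≤ DCRT.varHat (κ n) (m n) (D n ω)}) atTop (𝓝 1))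
    -- (NDG2); the two squares are real-valued, hence finite
    (hNDG2 : ∀ n (i : Fin n), ∀ᵐ ω ∂(P n),
      (0 < eVar[id; DCRT.lawHat (κ n) (D n ω) i] ∧
        eVar[id; DCRT.lawHat (κ n) (D n ω) i] < ∞) ∧
      0 < ((D n ω).y i - DCRT.muHatY (m n) (D n ω) i) ^ 2 ∧
      0 < ((D n ω).y i - DCRT.muY (L n) ((D n ω).z i)) ^ 2)
    -- (Lyap-1)
    (hLyap : ∃ δ : ℝ, 0 < δ ∧
      DCRT.TendstoInProb P (fun n ω => DCRT.lyapunovSum (κ n) (m n) δ (D n ω)) 0) :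
    DCRT.CondTendstoInDistribution (fun n => MeasurableSpace.comap (D n) inferInstance) P
      (fun n ω => DCRT.normStat (κ n) (m n) (Xt n ω) (D n ω)) (gaussianReal 0 1) ∧
    ∀ α : ℝ, α ∈ Set.Ioo (0 : ℝ) 1 →
      DCRT.TendstoInProb P
        (fun n => DCRT.condQuantile (1 - α)
          (fun ω => DCRT.normStat (κ n) (m n) (Xt n ω) (D n ω)) (D n) (P n))
        (DCRT.quantile (1 - α) (gaussianReal 0 1)) := by
  obtain ⟨ε, hε, hvarHat⟩ := hNDG1
  obtain ⟨δ, hδ, hlyap⟩ := hLyap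
  have hW : ∀ n, Measurable fun ω => DCRT.normStat (κ n) (m n) (Xt n ω) (D n ω) := fun n =>
    Measurable.comp (f := fun ω => (D n ω, Xt n ω))
      (g := fun a : DCRT.Sample n (p n) × (Fin n → ℝ) => DCRT.normStat (κ n) (m n) a.2 a.1)
      (DCRT.measurable_normStat (κ n) (hm n)) ((hD n).prodMk (hXt n))
  have hcond : ∀ n, ∀ᵐ ω ∂(P n),
      condDistrib (fun ω => DCRT.normStat (κ n) (m n) (Xt n ω) (D n ω)) (D n) (P n) (D n ω)
        = (DCRT.resampleLaw (κ n) (D n ω)).map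
            (fun xt => DCRT.normStat (κ n) (m n) xt (D n ω)) := by
    intro n
    have hfreeze := condDistrib_comp_prodMk_ae_eq (P := P n) (hD n) (hXt n)
      (f := fun a => DCRT.normStat (κ n) (m n) a.2 a.1) (DCRT.measurable_normStat (κ n) (hm n))
    filter_upwards [hresample n, hfreeze] with ω h1 h2
    rw [h2, h1]
  have hsmall := DCRT.tendsto_measure_lt_of_tendsto_measureReal_le
    (fun n => (DCRT.measurable_varHat (κ n) (hm n)).comp (hD n)) hvarHat
  -- closeness of the conditional distribution function, off events of vanishing probability
  have hclose : ∀ t η : ℝ, 0 < η → ∃ B : ∀ n, Set (Ω n),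
      Tendsto (fun n => P n (B n)) atTop (𝓝 0) ∧ ∀ n, ∀ᵐ ω ∂(P n), ω ∉ B n →
        |(condDistrib (fun ω => DCRT.normStat (κ n) (m n) (Xt n ω) (D n ω)) (D n) (P n)
          (D n ω)).real (Set.Iic t) - cdf (gaussianReal 0 1) t| < η := by
    intro t η hη
    obtain ⟨γ, hγ, H⟩ :=
      DCRT.exists_forall_abs_map_normStat_Iic_sub_gaussian_lt hδ hη hε t
    -- The exceptional event: small resampling variance or large Lyapunov sum.
    refine ⟨fun n => {ω | DCRT.varHat (κ n) (m n) (D n ω) < ε} ∪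
      {ω | γ ≤ edist (DCRT.lyapunovSum (κ n) (m n) δ (D n ω)) 0},
      DCRT.tendsto_measure_union_zero hsmall (hlyap γ hγ), fun n => ?_⟩
    · filter_upwards [hcond n, ae_all_iff.2 (hNDG2 n)] with ω hω hfin hnot
      rw [Set.mem_union, not_or] at hnot
      have hlt : DCRT.lyapunovSum (κ n) (m n) δ (D n ω) < γ := by
        rw [← ENNReal.edist_zero_eq_self (DCRT.lyapunovSum _ _ _ _)]
        exact not_le.1 hnot.2
      rw [hω]
      exact H n (p n) (κ n) inferInstance (m n) (D n ω) (fun i => (hfin i).1.2) (not_lt.1 hnot.1) hlt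
  constructor
  · intro t _
    refine DCRT.tendstoInProb_real_of_forall_ae fun η hη => ?_
    obtain ⟨B, hB, h⟩ := hclose t η hη
    refine ⟨B, hB, fun n => ?_⟩
    -- The regular conditional distribution is a version of the conditional probability given σ(D).
    filter_upwards [h n, condDistrib_ae_eq_condExp (μ := P n) (hD n) (hW n)
      (measurableSet_Iic (a := t))] with ω h1 h2 hnot
    have h3 := h1 hnot
    rw [h2] at h3
    exact h3
  · intro α hα
    refine DCRT.tendstoInProb_real_of_forall_ae fun η hη => ?_
    -- The quantile bound is not strict, so it is taken at η/2.
    obtain ⟨θ, hθ, b, c, hquant⟩ := DCRT.exists_forall_abs_quantile_sub_gaussian_le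
      (a := 1 - α) (by linarith [hα.2]) (by linarith [hα.1]) (half_pos hη)
    obtain ⟨B₁, hB₁, h₁⟩ := hclose b θ hθ
    obtain ⟨B₂, hB₂, h₂⟩ := hclose c θ hθ
    refine ⟨fun n => B₁ n ∪ B₂ n, DCRT.tendsto_measure_union_zero hB₁ hB₂, fun n => ?_⟩
    filter_upwards [h₁ n, h₂ n] with ω h1 h2 hnot
    rw [Set.mem_union, not_or] at hnot
    exact (hquant _ inferInstance (h1 hnot.1) (h2 hnot.2)).trans_lt (half_lt_self hη)
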